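/- \textbf{Theorem (Existence Theorem concerning $\mathbb{C}$).} Let $\tau\in\mathbb{C}$ be an imaginary quadratic algebraic integer, i.e., $\tau^2-p\tau+q=0$ with $p,q\in\mathbb{Z}$ and $4q-p^2>0$. Suppose that $|\tau|>1$, and let $w\ge 2$ be an integer. Let $V=\{z\in\mathbb{C} : |z|\le|z-y| \text{ for all } y\in\mathbb{Z}[\tau]\}$ be the Voronoi cell of $0$ in $\mathbb{Z}[\tau]$, let $v_0,\dots,v_{m-1}$ be its vertices, labelled counter-clockwise (starting at any vertex, indices modulo $m$), and let $v_{k+1/2}$ be the midpoint of $v_k$ and $v_{k+1}$. Let the restricted Voronoi cell $\widetilde V$ consist of the interior of $V$, the open line segments from $v_{k+1/2}$ to $v_{k+1}$ for all $k$, the points $v_{k+1/2}$ for $0\le k\le\lfloor m/2\rfloor-1$, and the points $v_k$ for $1\le k\le\lfloor m/3\rfloor$. Let $\mathcal{D}\subseteq\mathbb{Z}[\tau]$ be the minimal norm representatives digit set modulo $\tau^w$, i.e., $\mathcal{D}$ consists of $0$ and exactly one representative of each residue class of $\mathbb{Z}[\tau]$ modulo $\tau^w$ that is not divisible by $\tau$,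 and each non-zero element of $\mathcal{D}$ lies in $\tau^w\widetilde V$. A width-$w$ non-adjacent form ($w$-NAF) is a sequence $\boldsymbol{\xi}=(\xi_j)_{j\in\mathbb{Z}}\in\mathcal{D}^{\mathbb{Z}}$ such that each block $\xi_{j+w-1}\dots\xi_j$ of $w$ consecutive digits contains at most one non-zero digit; its left-length is $\sup(\{0\}\cup\{j+1 : \xi_j\ne 0\})$. Then for every $z\in\mathbb{C}$ there is a $w$-NAF $\boldsymbol{\xi}$ of finite left-length $\ell$ (and possibly infinitely many non-zero digits $\xi_j$ with $j<0$) whose value is $z$, i.e., \[ z=\sum_{j\in\mathbb{Z}}\xi_j\tau^j=\sum_{j<\ell}\xi_j\tau^j , \] where the series converges unconditionally. In other words, $z$ has an expansion $\xi_{\ell-1}\dots\xi_0.\xi_{-1}\xi_{-2}\dots$ in base $\tau$. -/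

import Mathlib

namespace WNAF

/-- `τ` is an imaginary quadratic algebraic integer: a root of `X² - pX + q` with integers `p, q`
satisfying `4q - p² > 0`. -/
def IsImagQuadraticInteger (τ : ℂ) : Prop :=
  ∃ p q : ℤ, 0 < 4 * q - p ^ 2 ∧ τ ^ 2 - p * τ + q = 0

/-- The ring `ℤ[τ] ⊆ ℂ`. -/
abbrev ZTau (τ : ℂ) : Subalgebra ℤ ℂ := Algebra.adjoin ℤ {τ}

/-- `τ` as an element of `ℤ[τ]`. -/
def tau (τ : ℂ) : ZTau τ := ⟨τ, Algebra.subset_adjoin (Set.mem_singleton τ)⟩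

/-- The Voronoi cell `V` of the lattice point `0` in `ℤ[τ]`. -/
def voronoiCell (τ : ℂ) : Set ℂ := {z | ∀ y ∈ ZTau τ, ‖z‖ ≤ ‖z - y‖}

/-- `v₀, …, v_{m-1}` (indices modulo `m`) are the vertices of `V`, labelled counter-clockwise:
they are the extreme points of `V`, without repetition, and for each `k` all other vertices lie
strictly to the left of the oriented line from `v_k` to `v_{k+1}`. The choice of the first vertex
is left free. -/
structure IsVertexLabelling (τ : ℂ) (m : ℕ) (v : ZMod m → ℂ) : Prop where
  three_le : 3 ≤ m
  injective : Function.Injective v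
  range_eq : Set.range v = (voronoiCell τ).extremePoints ℝ
  counterclockwise : ∀ k j : ZMod m, j ≠ k → j ≠ k + 1 →
    0 < ((starRingEnd ℂ) (v (k + 1) - v k) * (v j - v k)).im

/-- The restricted Voronoi cell of `0` with respect to a labelling of the vertices of `V`. With
`v_{k+1/2}` the midpoint of `v_k` and `v_{k+1}` it consists of the interior of `V`, the open
segments from `v_{k+1/2}` to `v_{k+1}`, the points `v_{k+1/2}` for `0 ≤ k ≤ ⌊m/2⌋ - 1`, and the
points `v_k` for `1 ≤ k ≤ ⌊m/3⌋`. -/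
def restrictedVoronoiCell (τ : ℂ) (m : ℕ) (v : ZMod m → ℂ) : Set ℂ :=
  interior (voronoiCell τ)
    ∪ (⋃ k : ZMod m, openSegment ℝ (midpoint ℝ (v k) (v (k + 1))) (v (k + 1)))
    ∪ {z | ∃ k : ℕ, k < m / 2 ∧ z = midpoint ℝ (v (k : ZMod m)) (v ((k : ZMod m) + 1))}
    ∪ {z | ∃ k : ℕ, 1 ≤ k ∧ k ≤ m / 3 ∧ z = v (k : ZMod m)}

/-- `D` is a reduced residue digit set modulo `τ ^ w`: it consists of `0` and exactly one
representative of each residue class of `ℤ[τ]` modulo `τ ^ w` that is not divisible by `τ`. -/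
structure IsReducedResidueDigitSet (τ : ℂ) (w : ℕ) (D : Set (ZTau τ)) : Prop where
  zero_mem : 0 ∈ D
  not_dvd : ∀ η ∈ D, η ≠ 0 → ¬ tau τ ∣ η
  existsUnique : ∀ z : ZTau τ, ¬ tau τ ∣ z → ∃! η, η ∈ D ∧ tau τ ^ w ∣ z - η

/-- `D` is a minimal norm representatives digit set modulo `τ ^ w`: a reduced residue digit set
all of whose non-zero digits lie in `τ ^ w Ṽ`, where `Ṽ` is the restricted Voronoi cell. -/
structure IsMinNormDigitSet (τ : ℂ) (w m : ℕ) (v : ZMod m → ℂ) (D : Set (ZTau τ)) : Prop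
    extends IsReducedResidueDigitSet τ w D where
  mem_cell : ∀ η ∈ D, η ≠ 0 → ∃ x ∈ restrictedVoronoiCell τ m v, (η : ℂ) = τ ^ w * x

/-- `η` is a width-`w` non-adjacent form over `D`: a two-sided sequence of digits such that each
block of `w` consecutive digits contains at most one non-zero digit. -/
structure IsWNAF {τ : ℂ} (w : ℕ) (D : Set (ZTau τ)) (η : ℤ → ZTau τ) : Prop where
  digit_mem : ∀ j, η j ∈ D
  block : ∀ j : ℤ, {i : ℤ | j ≤ i ∧ i < j + w ∧ η i ≠ 0}.Subsingleton

/-- The left-length `sup ({0} ∪ {j + 1 | η j ≠ 0})`. -/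
noncomputable def leftLength {τ : ℂ} (η : ℤ → ZTau τ) : ℕ∞ :=
  ⨆ j ∈ {j : ℤ | η j ≠ 0}, ((j + 1).toNat : ℕ∞)

/-- The set of width-`w` non-adjacent forms of finite left-length and arbitrary (possibly
infinite) right-length. -/
def wnafFinInf {τ : ℂ} (w : ℕ) (D : Set (ZTau τ)) : Set (ℤ → ZTau τ) :=
  {η | IsWNAF w D η ∧ leftLength η < ⊤}

/-- `z` is the value of `η`: the two-sided series `∑ η_j τ ^ j` converges (unconditionally)
to `z`. -/
def HasValue {τ : ℂ} (η : ℤ → ZTau τ) (z : ℂ) : Prop :=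
  HasSum (fun j : ℤ => (η j : ℂ) * τ ^ j) z

end WNAF

/-!
Fix `τ` with `τ² = pτ - q`, so that `‖τ‖² = q`. Reading off the digit `d y` of `y ∈ ℤ[τ]` (zero
if `τ ∣ y`, the representative of the class of `y` modulo `τ ^ w` otherwise) and passing to
`T y = (y - d y) / τ` produces digits `d y, d (T y), d (T² y), …`. A non-zero digit leaves a number
divisible by `τ ^ (w - 1)`, hence is followed by `w - 1` zeros: the non-adjacency condition is
automatic.

The orbit of every `y` reaches `0` (`IsDigitMap.exists_iterate_eq_zero`). Indeed `d y` has minimal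
norm in its class, so `‖d y‖ ≤ ‖y‖`, and for `τ ∤ y` the `w`-th iterate `y' = (y - d y) / τ ^ w`
satisfies `‖τ‖ ^ w * ‖y'‖ ≤ 2 * ‖y‖`. If `q ^ w > 4` the integer `‖y‖²` strictly decreases, as it does on
dividing by `τ`. The
remaining case is `q = w = 2`, where it fails to decrease only if `d y = -y`, so that
`y' = (2 / τ²) y`. This is impossible for `p = ±1`; for `p = 0` the factor is `-1`, and for `p = ±2`
its square is `-1`, so that after at most two such steps either the norm has decreased or the
digit `-y` itself is reached.

For `z ∈ ℂ` let `y n ∈ ℤ[τ]` be within bounded distance of `τ ^ n z`. Shifting the expansion of `y n`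
by `n` places gives an expansion of `y n / τ ^ n`, and these numbers tend to `z`. The map `T`
contracts up to a bounded error, so the `n`-th iterates `T^[n] (y n)` lie in a finite set, and the
left-lengths of the shifted expansions are bounded independently of `n`. The digit set is finite,
so a subsequence of the expansions converges digit by digit; the limit is a `w`-NAF, and by dominated
convergence its value is `z`.
-/

open Filter Topology

namespace WNAF

variable {τ : ℂ} {p q : ℤ} {w m : ℕ} {D : Set (ZTau τ)} {d T : ZTau τ → ZTau τ}

/-! ### The lattice `ℤ[τ]` -/

@[simp] lemma coe_tau : ((tau τ : ZTau τ) : ℂ) = τ := rfl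

lemma re_im_of_root (hpq : 0 < 4 * q - p ^ 2) (hτ : τ ^ 2 - p * τ + q = 0) :
    2 * τ.re = p ∧ 0 < τ.im ^ 2 ∧ τ.re ^ 2 + τ.im ^ 2 = q := by
  have hre := congrArg Complex.re hτ
  have him := congrArg Complex.im hτ
  simp only [sq, Complex.add_re, Complex.sub_re, Complex.mul_re, Complex.intCast_re,
    Complex.intCast_im, Complex.add_im, Complex.sub_im, Complex.mul_im, Complex.zero_re,
    Complex.zero_im] at hre him
  have hpq' : (0 : ℝ) < 4 * q - p ^ 2 := by exact_mod_cast hpq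
  have him0 : τ.im ≠ 0 := by
    intro h
    rw [h] at hre
    nlinarith [sq_nonneg (2 * τ.re - p)]
  have h2 : 2 * τ.re = p := by
    have : τ.im * (2 * τ.re - p) = 0 := by linarith
    rcases mul_eq_zero.1 this with h | h
    · exact absurd h him0
    · linarith
  refine ⟨h2, by positivity, ?_⟩
  rw [← h2] at hre
  nlinarith

lemma norm_sq_tau (hpq : 0 < 4 * q - p ^ 2) (hτ : τ ^ 2 - p * τ + q = 0) : ‖τ‖ ^ 2 = q := by
  rw [← (re_im_of_root hpq hτ).2.2, Complex.sq_norm, Complex.normSq_apply]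
  ring

lemma exists_coords (hτ : τ ^ 2 - p * τ + q = 0) (y : ZTau τ) :
    ∃ a b : ℤ, (y : ℂ) = a + b * τ := by
  obtain ⟨y, hy⟩ := y
  induction hy using Algebra.adjoin_induction with
  | mem x hx =>
    rw [Set.mem_singleton_iff] at hx
    exact ⟨0, 1, by simp [hx]⟩
  | algebraMap r => exact ⟨r, 0, by simp⟩
  | add x y _ _ hx hy =>
    obtain ⟨a, b, h⟩ := hx
    obtain ⟨c, e, h'⟩ := hy
    simp only at h h' ⊢
    exact ⟨a + c, b + e, by rw [h, h']; push_cast; ring⟩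
  | mul x y _ _ hx hy =>
    obtain ⟨a, b, h⟩ := hx
    obtain ⟨c, e, h'⟩ := hy
    simp only at h h' ⊢
    refine ⟨a * c - q * b * e, a * e + b * c + p * b * e, ?_⟩
    rw [h, h']
    push_cast
    linear_combination (b * e : ℂ) * hτ

/-- The element `a + bτ` of `ℤ[τ]`. -/
def ofCoords (τ : ℂ) (a b : ℤ) : ZTau τ := a + b * tau τ

@[simp] lemma coe_ofCoords (a b : ℤ) : (ofCoords τ a b : ℂ) = a + b * τ := by
  simp [ofCoords]

lemma exists_norm_sq_eq_natCast (hpq : 0 < 4 * q - p ^ 2) (hτ : τ ^ 2 - p * τ + q = 0)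
    (y : ZTau τ) : ∃ n : ℕ, ‖(y : ℂ)‖ ^ 2 = n := by
  obtain ⟨a, b, h⟩ := exists_coords hτ y
  obtain ⟨h1, -, h3⟩ := re_im_of_root hpq hτ
  have key : ‖(y : ℂ)‖ ^ 2 = ((a ^ 2 + p * a * b + q * b ^ 2 : ℤ) : ℝ) := by
    rw [h, Complex.sq_norm, Complex.normSq_apply]
    simp only [Complex.add_re, Complex.mul_re, Complex.intCast_re, Complex.intCast_im,
      Complex.add_im, Complex.mul_im]
    push_cast
    rw [← h1, ← h3]
    ring
  have hnn : 0 ≤ a ^ 2 + p * a * b + q * b ^ 2 := by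
    have : (0 : ℝ) ≤ ((a ^ 2 + p * a * b + q * b ^ 2 : ℤ) : ℝ) := key ▸ sq_nonneg _
    exact_mod_cast this
  lift a ^ 2 + p * a * b + q * b ^ 2 to ℕ using hnn with n
  exact ⟨n, by rw [key]; simp⟩

lemma finite_norm_le (hpq : 0 < 4 * q - p ^ 2) (hτ : τ ^ 2 - p * τ + q = 0) (C : ℝ) :
    {y : ZTau τ | ‖(y : ℂ)‖ ≤ C}.Finite := by
  obtain ⟨-, h2, -⟩ := re_im_of_root hpq hτ
  have him : 0 < |τ.im| := abs_pos.2 fun h => by simp [h] at h2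
  -- `|b| * |Im τ| ≤ C` bounds `b`, and then `|a| ≤ C + |b| * ‖τ‖` bounds `a`
  set B : ℝ := C / |τ.im|
  set A : ℝ := C + B * ‖τ‖
  refine ((Set.finite_Icc (-⌈A⌉) ⌈A⌉).prod (Set.finite_Icc (-⌈B⌉) ⌈B⌉)).image
    (fun x : ℤ × ℤ => ofCoords τ x.1 x.2) |>.subset ?_
  intro y hy
  obtain ⟨a, b, h⟩ := exists_coords hτ y
  have hy' : ‖(a : ℂ) + b * τ‖ ≤ C := h ▸ hy
  have hb : |(b : ℝ)| ≤ B := by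
    rw [le_div_iff₀ him, ← abs_mul]
    refine le_trans (le_of_eq ?_) ((Complex.abs_im_le_norm _).trans hy')
    simp
  have ha : |(a : ℝ)| ≤ A := by
    have e : (a : ℂ) = (a + b * τ) - b * τ := by ring
    have h1 : ‖(a : ℂ)‖ ≤ ‖(a : ℂ) + b * τ‖ + ‖(b : ℂ) * τ‖ := by
      conv_lhs => rw [e]
      exact norm_sub_le _ _
    rw [norm_mul, Complex.norm_intCast, Complex.norm_intCast] at h1
    have := mul_le_mul_of_nonneg_right hb (norm_nonneg τ)
    simp only [A]
    linarith
  have cast : ∀ {c : ℤ} {X : ℝ}, |(c : ℝ)| ≤ X → c ∈ Set.Icc (-⌈X⌉) ⌈X⌉ := by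
    intro c X hc
    obtain ⟨h1, h2⟩ := abs_le.1 hc
    have h3 := Int.le_ceil X
    constructor
    · have : (-⌈X⌉ : ℝ) ≤ c := by linarith
      exact_mod_cast this
    · have : (c : ℝ) ≤ ⌈X⌉ := by linarith
      exact_mod_cast this
  exact ⟨(a, b), ⟨cast ha, cast hb⟩, Subtype.ext (by simp [h])⟩

lemma exists_norm_sub_le (hpq : 0 < 4 * q - p ^ 2) (hτ : τ ^ 2 - p * τ + q = 0) (x : ℂ) :
    ∃ y : ZTau τ, ‖x - y‖ ≤ (1 + ‖τ‖) / 2 := by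
  obtain ⟨-, h2, -⟩ := re_im_of_root hpq hτ
  have him : τ.im ≠ 0 := fun h => by simp [h] at h2
  set s : ℝ := x.im / τ.im
  set r : ℝ := x.re - s * τ.re
  have hx : x = r + s * τ := by
    apply Complex.ext
    · simp [r]
    · simp [s, div_mul_cancel₀ _ him]
  refine ⟨ofCoords τ (round r) (round s), ?_⟩
  have e : x - (ofCoords τ (round r) (round s) : ℂ)
      = ((r - round r : ℝ) : ℂ) + ((s - round s : ℝ) : ℂ) * τ := by
    rw [coe_ofCoords]
    nth_rw 1 [hx]
    push_cast
    ring
  rw [e]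
  refine (norm_add_le _ _).trans ?_
  rw [norm_mul, Complex.norm_real, Complex.norm_real, Real.norm_eq_abs, Real.norm_eq_abs]
  have h3 := abs_sub_round r
  have h4 := mul_le_mul_of_nonneg_right (abs_sub_round s) (norm_nonneg τ)
  linarith

/-! ### The Voronoi cell -/

lemma convex_voronoiCell : Convex ℝ (voronoiCell τ) := by
  -- `‖z‖ ≤ ‖z - y‖` says that `2 Re (z ȳ) ≤ ‖y‖²`, a half-plane
  have key : ∀ x y : ℂ, ‖x‖ ≤ ‖x - y‖ ↔ 2 * (x.re * y.re + x.im * y.im) ≤ y.re ^ 2 + y.im ^ 2 := by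
    intro x y
    rw [← sq_le_sq₀ (norm_nonneg _) (norm_nonneg _), Complex.sq_norm, Complex.sq_norm,
      Complex.normSq_apply, Complex.normSq_apply, Complex.sub_re, Complex.sub_im]
    constructor <;> intro h <;> nlinarith
  intro x hx y hy a b ha hb hab u hu
  have h1 := mul_le_mul_of_nonneg_left ((key x u).1 (hx u hu)) ha
  have h2 := mul_le_mul_of_nonneg_left ((key y u).1 (hy u hu)) hb
  rw [key]
  simp only [Complex.add_re, Complex.add_im, Complex.real_smul, Complex.mul_re, Complex.mul_im,
    Complex.ofReal_re, Complex.ofReal_im]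
  obtain rfl : b = 1 - a := by linarith
  linarith

lemma restrictedVoronoiCell_subset {v : ZMod m → ℂ} (hv : IsVertexLabelling τ m v) :
    restrictedVoronoiCell τ m v ⊆ voronoiCell τ := by
  have hmem : ∀ k, v k ∈ voronoiCell τ := fun k =>
    extremePoints_subset (hv.range_eq ▸ Set.mem_range_self k)
  have hmid : ∀ k l, midpoint ℝ (v k) (v l) ∈ voronoiCell τ := fun k l =>
    convex_voronoiCell.midpoint_mem (hmem k) (hmem l)
  rintro x (((hx | hx) | ⟨k, -, rfl⟩) | ⟨k, -, -, rfl⟩)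
  · exact interior_subset hx
  · obtain ⟨k, hk⟩ := Set.mem_iUnion.1 hx
    exact convex_voronoiCell.openSegment_subset (hmid _ _) (hmem _) hk
  · exact hmid _ _
  · exact hmem _

/-- A digit is no longer than any other element of its residue class modulo `τ ^ w`. -/
lemma IsMinNormDigitSet.norm_le_norm_sub {v : ZMod m → ℂ} (hv : IsVertexLabelling τ m v)
    (hD : IsMinNormDigitSet τ w m v D) {η : ZTau τ} (hη : η ∈ D) (x : ZTau τ) :
    ‖(η : ℂ)‖ ≤ ‖(η : ℂ) - τ ^ w * x‖ := by
  by_cases h0 : η = 0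
  · rw [h0, ZeroMemClass.coe_zero, norm_zero]
    exact norm_nonneg _
  obtain ⟨y, hy, h⟩ := hD.mem_cell η hη h0
  rw [h, ← mul_sub, norm_mul, norm_mul]
  exact mul_le_mul_of_nonneg_left (restrictedVoronoiCell_subset hv hy x x.2) (norm_nonneg _)

lemma IsMinNormDigitSet.norm_le (hpq : 0 < 4 * q - p ^ 2) (hτ : τ ^ 2 - p * τ + q = 0)
    (hτ0 : τ ≠ 0) {v : ZMod m → ℂ} (hv : IsVertexLabelling τ m v)
    (hD : IsMinNormDigitSet τ w m v D) {η : ZTau τ} (hη : η ∈ D) :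
    ‖(η : ℂ)‖ ≤ ‖τ‖ ^ w * ((1 + ‖τ‖) / 2) := by
  obtain ⟨x, hx⟩ := exists_norm_sub_le hpq hτ ((η : ℂ) / τ ^ w)
  refine (hD.norm_le_norm_sub hv hη x).trans ?_
  have e : (η : ℂ) - τ ^ w * x = τ ^ w * ((η : ℂ) / τ ^ w - x) := by
    field_simp
  rw [e, norm_mul, norm_pow]
  gcongr

/-! ### Reading off the digits of an element of `ℤ[τ]` -/

/-- `d y` is the last digit of `y` in its `w`-NAF, and `T y = (y - d y) / τ` is the number
represented by the remaining digits. -/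
structure IsDigitMap (w : ℕ) (D : Set (ZTau τ)) (d T : ZTau τ → ZTau τ) : Prop where
  mem : ∀ y, d y ∈ D
  eq_add : ∀ y, y = d y + tau τ * T y
  eq_zero : ∀ y, tau τ ∣ y → d y = 0
  dvd_sub : ∀ y, ¬ tau τ ∣ y → tau τ ^ w ∣ y - d y

lemma IsReducedResidueDigitSet.exists_isDigitMap (hw : w ≠ 0)
    (hD : IsReducedResidueDigitSet τ w D) : ∃ d T, IsDigitMap w D d T := by
  have key : ∀ y : ZTau τ, ∃ η x : ZTau τ, η ∈ D ∧ y = η + tau τ * x ∧ (tau τ ∣ y → η = 0) ∧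
      (¬ tau τ ∣ y → tau τ ^ w ∣ y - η) := by
    intro y
    by_cases hy : tau τ ∣ y
    · obtain ⟨x, rfl⟩ := hy
      exact ⟨0, x, hD.zero_mem, by simp, fun _ => rfl, fun h => absurd (dvd_mul_right _ _) h⟩
    · obtain ⟨η, ⟨hη, h⟩, -⟩ := hD.existsUnique y hy
      obtain ⟨x, hx⟩ := (dvd_pow_self (tau τ) hw).trans h
      exact ⟨η, x, hη, by rw [← hx]; ring, fun h => absurd h hy, fun _ => h⟩
  choose d T h1 h2 h3 h4 using key
  exact ⟨d, T, h1, h2, h3, h4⟩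

lemma tau_ne_zero (hτ0 : τ ≠ 0) : tau τ ≠ 0 := fun h => hτ0 (congrArg Subtype.val h)

namespace IsDigitMap

lemma T_tau_mul (h : IsDigitMap w D d T) (hτ0 : τ ≠ 0) (x : ZTau τ) : T (tau τ * x) = x := by
  have h1 := h.eq_add (tau τ * x)
  rw [h.eq_zero _ (dvd_mul_right _ _), zero_add] at h1
  exact (mul_left_cancel₀ (tau_ne_zero hτ0) h1).symm

lemma iterate_tau_pow_mul (h : IsDigitMap w D d T) (hτ0 : τ ≠ 0) (k : ℕ) (x : ZTau τ) :
    T^[k] (tau τ ^ k * x) = x := by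
  induction k with
  | zero => simp
  | succ k ih => rw [Function.iterate_succ_apply, pow_succ', mul_assoc, h.T_tau_mul hτ0, ih]

lemma iterate_zero (h : IsDigitMap w D d T) (hτ0 : τ ≠ 0) (k : ℕ) : T^[k] 0 = 0 := by
  simpa using h.iterate_tau_pow_mul hτ0 k 0

lemma iterate_eq_zero_of_le (h : IsDigitMap w D d T) (hτ0 : τ ≠ 0) {y : ZTau τ} {k l : ℕ}
    (hkl : k ≤ l) (hk : T^[k] y = 0) : T^[l] y = 0 := by
  obtain ⟨c, rfl⟩ := Nat.exists_eq_add_of_le' hkl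
  rw [Function.iterate_add_apply, hk, h.iterate_zero hτ0]

lemma exists_eq_add_pow_mul (h : IsDigitMap w D d T) (hτ0 : τ ≠ 0) (hw : w ≠ 0) {y : ZTau τ}
    (hy : ¬ tau τ ∣ y) : ∃ x, y = d y + tau τ ^ w * x ∧
      ∀ i < w, T^[i + 1] y = tau τ ^ (w - 1 - i) * x := by
  obtain ⟨x, hx⟩ := h.dvd_sub y hy
  obtain ⟨w, rfl⟩ := Nat.exists_eq_succ_of_ne_zero hw
  refine ⟨x, by rw [← hx]; ring, fun i hi => ?_⟩
  have h1 := h.eq_add y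
  have hT : T y = tau τ ^ w * x := by
    apply mul_left_cancel₀ (tau_ne_zero hτ0)
    rw [← mul_assoc, ← pow_succ', ← hx]
    exact eq_sub_of_add_eq' h1.symm
  obtain ⟨c, rfl⟩ := Nat.exists_eq_add_of_le (Nat.lt_succ_iff.1 hi)
  have e : i + c + 1 - 1 - i = c := by omega
  rw [Function.iterate_succ_apply, hT, pow_add, mul_assoc, h.iterate_tau_pow_mul hτ0, ← e]
  simp

lemma digit_iterate_eq_zero (h : IsDigitMap w D d T) (hτ0 : τ ≠ 0) (hw : w ≠ 0) {y : ZTau τ}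
    (hy : d y ≠ 0) {i : ℕ} (hi0 : i ≠ 0) (hi : i < w) : d (T^[i] y) = 0 := by
  obtain ⟨x, -, hx⟩ := h.exists_eq_add_pow_mul hτ0 hw (fun hd => hy (h.eq_zero y hd))
  obtain ⟨i, rfl⟩ := Nat.exists_eq_succ_of_ne_zero hi0
  apply h.eq_zero
  rw [Nat.succ_eq_add_one, hx i (by omega)]
  exact (dvd_pow_self _ (by omega)).mul_right _

lemma digit_eq_self (h : IsDigitMap w D d T) (hD : IsReducedResidueDigitSet τ w D) {y : ZTau τ}
    (hy : y ∈ D) : d y = y := by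
  by_cases h0 : y = 0
  · rw [h0, h.eq_zero 0 (dvd_zero _)]
  have hd := hD.not_dvd y hy h0
  exact (hD.existsUnique y hd).unique ⟨h.mem y, h.dvd_sub y hd⟩ ⟨hy, by simp⟩

lemma T_eq_zero_of_mem (h : IsDigitMap w D d T) (hD : IsReducedResidueDigitSet τ w D)
    (hτ0 : τ ≠ 0) {y : ZTau τ} (hy : y ∈ D) : T y = 0 := by
  have h1 := h.eq_add y
  rw [h.digit_eq_self hD hy, left_eq_add, mul_eq_zero] at h1
  exact h1.resolve_left (tau_ne_zero hτ0)

/-! ### Termination -/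

/-- Some iterate of a non-zero element either is shorter or arises in the exceptional case
`‖τ‖ ^ w = 2` with digit `d y = -y`. -/
lemma exists_norm_iterate_lt_or (h : IsDigitMap w D d T) (hτ1 : 1 < ‖τ‖) (hw : w ≠ 0)
    (hτw : 2 ≤ ‖τ‖ ^ w) (hmin : ∀ η ∈ D, ∀ x : ZTau τ, ‖(η : ℂ)‖ ≤ ‖(η : ℂ) - τ ^ w * x‖)
    {y : ZTau τ} (hy : y ≠ 0) :
    (∃ k, ‖(T^[k] y : ℂ)‖ < ‖(y : ℂ)‖) ∨
      (¬ tau τ ∣ y ∧ ‖τ‖ ^ w = 2 ∧ -y ∈ D ∧ 2 * y = tau τ ^ w * T^[w] y) := by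
  have hτ0 : τ ≠ 0 := by rintro rfl; simp at hτ1; linarith
  have hy0 : 0 < ‖(y : ℂ)‖ := norm_pos_iff.2 fun h => hy (Subtype.ext h)
  by_cases hd : tau τ ∣ y
  · left
    obtain ⟨x, rfl⟩ := hd
    refine ⟨1, ?_⟩
    have hx : 0 < ‖(x : ℂ)‖ := norm_pos_iff.2 fun h0 => hy (by
      have : x = 0 := Subtype.ext h0
      rw [this, mul_zero])
    simp only [Function.iterate_one, h.T_tau_mul hτ0, MulMemClass.coe_mul, coe_tau, norm_mul]
    nlinarith
  obtain ⟨x, hyx, hT⟩ := h.exists_eq_add_pow_mul hτ0 hw hd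
  have hTw : T^[w] y = x := by
    have := hT (w - 1) (by omega)
    rwa [Nat.sub_add_cancel (by omega), Nat.sub_self, pow_zero, one_mul] at this
  have hyx' : (y : ℂ) = d y + τ ^ w * x := by simpa using congrArg Subtype.val hyx
  have hdy : ‖(d y : ℂ)‖ ≤ ‖(y : ℂ)‖ := by
    have := hmin (d y) (h.mem y) (-x)
    rwa [NegMemClass.coe_neg, mul_neg, sub_neg_eq_add, ← hyx'] at this
  by_cases hlt : ‖(x : ℂ)‖ < ‖(y : ℂ)‖
  · exact Or.inl ⟨w, hTw ▸ hlt⟩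
  right
  rw [not_lt] at hlt
  have hx : τ ^ w * (x : ℂ) = y - d y := by rw [hyx']; ring
  have hn : ‖τ‖ ^ w * ‖(x : ℂ)‖ = ‖(y : ℂ) - d y‖ := by rw [← hx, norm_mul, norm_pow]
  have h2 : ‖(y : ℂ) - d y‖ ≤ ‖(y : ℂ)‖ + ‖(d y : ℂ)‖ := norm_sub_le _ _
  have h3 : 2 * ‖(y : ℂ)‖ ≤ ‖τ‖ ^ w * ‖(x : ℂ)‖ := by gcongr
  have hneg : (d y : ℂ) = -y := by
    -- equality in the triangle inequality, via the parallelogram law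
    have h4 := parallelogram_law_with_norm ℝ (y : ℂ) (d y : ℂ)
    have h5 : ‖(y : ℂ) + d y‖ = 0 := by
      have := norm_nonneg ((y : ℂ) + d y)
      nlinarith [norm_nonneg (d y : ℂ)]
    rw [norm_eq_zero] at h5
    exact eq_neg_of_add_eq_zero_right h5
  have hneg' : d y = -y := Subtype.ext hneg
  refine ⟨hd, ?_, hneg' ▸ h.mem y, ?_⟩
  · have h6 : ‖τ‖ ^ w * ‖(x : ℂ)‖ ≤ 2 * ‖(y : ℂ)‖ := by linarith
    have h7 : ‖τ‖ ^ w * ‖(y : ℂ)‖ ≤ 2 * ‖(y : ℂ)‖ := by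
      refine le_trans ?_ h6
      gcongr
    exact le_antisymm (le_of_mul_le_mul_right h7 hy0) hτw
  · rw [hTw]
    rw [hneg'] at hyx
    linear_combination hyx

theorem exists_iterate_eq_zero (h : IsDigitMap w D d T) (hD : IsReducedResidueDigitSet τ w D)
    (hpq : 0 < 4 * q - p ^ 2) (hτ : τ ^ 2 - p * τ + q = 0) (hτ1 : 1 < ‖τ‖) (hw : 2 ≤ w)
    (hmin : ∀ η ∈ D, ∀ x : ZTau τ, ‖(η : ℂ)‖ ≤ ‖(η : ℂ) - τ ^ w * x‖) (y : ZTau τ) :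
    ∃ k, T^[k] y = 0 := by
  have hτ0 : τ ≠ 0 := by rintro rfl; simp at hτ1; linarith
  have hq := norm_sq_tau hpq hτ
  have hq2 : 2 ≤ q := by
    have : (1 : ℝ) < q := by rw [← hq]; nlinarith
    have : 1 < q := by exact_mod_cast this
    omega
  have hτw : (q : ℝ) ≤ ‖τ‖ ^ w := hq ▸ pow_le_pow_right₀ hτ1.le hw
  have hτw2 : 2 ≤ ‖τ‖ ^ w := le_trans (by exact_mod_cast hq2) hτw
  obtain ⟨n, hn⟩ := exists_norm_sq_eq_natCast hpq hτ y
  induction n using Nat.strong_induction_on generalizing y with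
  | _ n ih =>
  by_cases hy : y = 0
  · exact ⟨0, hy⟩
  have descend : ∀ k l : ℕ, ‖(T^[l] (T^[k] y) : ℂ)‖ < ‖(y : ℂ)‖ → ∃ k, T^[k] y = 0 := by
    intro k l hlt
    obtain ⟨n', hn'⟩ := exists_norm_sq_eq_natCast hpq hτ (T^[l] (T^[k] y))
    have hlt' : (n' : ℝ) < n := by
      rw [← hn, ← hn']
      gcongr
    obtain ⟨j, hj⟩ := ih n' (by exact_mod_cast hlt') _ hn'
    exact ⟨j + l + k, by rwa [Function.iterate_add_apply, Function.iterate_add_apply]⟩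
  have hmin' := fun {y : ZTau τ} (hy : y ≠ 0) =>
    h.exists_norm_iterate_lt_or hτ1 (by omega) hτw2 hmin hy
  rcases hmin' hy with ⟨k, hk⟩ | ⟨hd, hτw', hyD, hyT⟩
  · exact descend 0 k hk
  -- now `‖τ‖ ^ w = 2`, so `q = w = 2`
  obtain rfl : q = 2 := by
    rw [hτw'] at hτw
    have : q ≤ 2 := by exact_mod_cast hτw
    omega
  obtain rfl : w = 2 := by
    refine le_antisymm (not_lt.1 fun hw3 => ?_) hw
    have : ‖τ‖ ^ 2 < ‖τ‖ ^ w := pow_lt_pow_right₀ hτ1 hw3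
    rw [hq, hτw'] at this
    norm_num at this
  set x := T^[2] y with hx
  have h2 : ((2 : ZTau τ) : ℂ) = 2 := rfl
  have ht : tau τ ^ 2 = p * tau τ - 2 := Subtype.ext (by
    push_cast
    simp only [coe_tau, h2]
    push_cast at hτ
    linear_combination hτ)
  have cancel : ∀ {a b : ZTau τ}, tau τ ^ 2 * a = tau τ ^ 2 * b → a = b := fun hab =>
    mul_left_cancel₀ (pow_ne_zero 2 (tau_ne_zero hτ0)) hab
  have finish : ∀ k, T^[k] y = -y → ∃ k, T^[k] y = 0 := fun k hk =>
    ⟨1 + k, by rw [Function.iterate_add_apply, hk, Function.iterate_one,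
      h.T_eq_zero_of_mem hD hτ0 hyD]⟩
  have hp : p = 0 ∨ p ^ 2 = 1 ∨ p ^ 2 = 4 := by
    have h1 : -3 < p := by nlinarith
    have h2 : p < 3 := by nlinarith
    interval_cases p <;> simp
  rcases hp with rfl | hp | hp
  · apply finish 2
    apply cancel
    rw [← hx, ← hyT, ht]
    push_cast
    ring
  · -- `2 = τ * (p - τ)`, so `τ` divides `(p - τ) * y`, hence `p * y`, and `p` is a unit
    refine absurd ?_ hd
    have hp' : (p : ZTau τ) ^ 2 = 1 := by exact_mod_cast congrArg (Int.cast (R := ZTau τ)) hp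
    have h1 : (p - tau τ) * y = tau τ * x := by
      apply mul_left_cancel₀ (tau_ne_zero hτ0)
      linear_combination hyT - y * ht
    refine ⟨p * (x + y), ?_⟩
    linear_combination p * h1 - y * hp'
  · have hp' : (p : ZTau τ) ^ 2 = 4 := by exact_mod_cast congrArg (Int.cast (R := ZTau τ)) hp
    have ht4 : tau τ ^ 2 * tau τ ^ 2 = -4 := by
      linear_combination (tau τ ^ 2 + p * tau τ - 2 + 4) * ht + tau τ ^ 2 * hp'
    have hxy : ‖(x : ℂ)‖ = ‖(y : ℂ)‖ := by
      have := congrArg (fun a : ZTau τ => ‖(a : ℂ)‖) hyT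
      simp only [MulMemClass.coe_mul, SubmonoidClass.coe_pow, coe_tau, norm_mul, norm_pow,
        hτw'] at this
      rw [h2, Complex.norm_ofNat] at this
      linarith
    have hx0 : x ≠ 0 := by
      intro h0
      rw [h0] at hxy
      exact hy (Subtype.ext (norm_eq_zero.1 (by simpa using hxy.symm)))
    rcases hmin' hx0 with ⟨k, hk⟩ | ⟨-, -, -, hxT⟩
    · exact descend 2 k (hxy ▸ hk)
    · apply finish (2 + 2)
      rw [Function.iterate_add_apply, ← hx]
      apply cancel
      apply cancel
      rw [← hxT]
      linear_combination (-2 : ZTau τ) * hyT + y * ht4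

/-! ### Expansions of elements of `ℤ[τ]` -/

lemma sum_range_add (h : IsDigitMap w D d T) (y : ZTau τ) (k : ℕ) :
    (y : ℂ) = ∑ i ∈ Finset.range k, (d (T^[i] y) : ℂ) * τ ^ i + τ ^ k * T^[k] y := by
  induction k with
  | zero => simp
  | succ k ih =>
    have h1 : ((T^[k] y : ZTau τ) : ℂ) = d (T^[k] y) + τ * T^[k + 1] y := by
      rw [Function.iterate_succ_apply']
      simpa using congrArg Subtype.val (h.eq_add (T^[k] y))
    rw [Finset.sum_range_succ]
    nth_rw 1 [ih]
    rw [h1]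
    ring

lemma norm_iterate_le (h : IsDigitMap w D d T) (hτ1 : 1 < ‖τ‖) {M : ℝ}
    (hM : ∀ η ∈ D, ‖(η : ℂ)‖ ≤ M) (y : ZTau τ) (k : ℕ) :
    ‖(T^[k] y : ℂ)‖ ≤ ‖(y : ℂ)‖ / ‖τ‖ ^ k + M / (‖τ‖ - 1) := by
  have hM0 : 0 ≤ M := (norm_nonneg _).trans (hM _ (h.mem 0))
  have ht : 0 < ‖τ‖ := by linarith
  have ht1 : ‖τ‖ - 1 ≠ 0 := by linarith
  induction k with
  | zero =>
    have : 0 ≤ M / (‖τ‖ - 1) := div_nonneg hM0 (by linarith)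
    simpa using this
  | succ k ih =>
    have h1 : τ * (T^[k + 1] y : ZTau τ) = (T^[k] y : ZTau τ) - (d (T^[k] y) : ℂ) := by
      rw [Function.iterate_succ_apply']
      nth_rw 2 [h.eq_add (T^[k] y)]
      simp
    have h2 : ‖τ‖ * ‖(T^[k + 1] y : ℂ)‖ ≤ ‖(T^[k] y : ℂ)‖ + M := by
      rw [← norm_mul, h1]
      exact (norm_sub_le _ _).trans (by gcongr; exact hM _ (h.mem _))
    refine le_of_mul_le_mul_left (h2.trans ?_) ht
    have e : ‖τ‖ * (‖(y : ℂ)‖ / ‖τ‖ ^ (k + 1) + M / (‖τ‖ - 1))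
        = ‖(y : ℂ)‖ / ‖τ‖ ^ k + M / (‖τ‖ - 1) + M := by
      field_simp
      ring
    rw [e]
    linarith

end IsDigitMap

/-- The digits of `y / τ ^ n`: those of `y`, shifted by `n` places to the right. -/
noncomputable def shiftedDigits (d T : ZTau τ → ZTau τ) (y : ZTau τ) (n : ℕ) (j : ℤ) : ZTau τ :=
  if -n ≤ j then d (T^[(j + n).toNat] y) else 0

lemma shiftedDigits_natCast_sub (y : ZTau τ) (n k : ℕ) :
    shiftedDigits d T y n (k - n) = d (T^[k] y) := by
  simp [shiftedDigits]

namespace IsDigitMap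

lemma isWNAF_shiftedDigits (h : IsDigitMap w D d T) (hD : IsReducedResidueDigitSet τ w D)
    (hτ0 : τ ≠ 0) (hw : w ≠ 0) (y : ZTau τ) (n : ℕ) : IsWNAF w D (shiftedDigits d T y n) where
  digit_mem j := by
    rw [shiftedDigits]
    split_ifs
    exacts [h.mem _, hD.zero_mem]
  block j := by
    have key : ∀ a b : ℤ, a < b → b < a + w → shiftedDigits d T y n a ≠ 0 →
        shiftedDigits d T y n b = 0 := by
      intro a b hab hb ha
      have han : -(n : ℤ) ≤ a := by
        by_contra hc
        simp [shiftedDigits, hc] at ha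
      obtain ⟨k, hk⟩ := Int.eq_ofNat_of_zero_le (show 0 ≤ a + n by omega)
      obtain ⟨i, hi⟩ := Int.eq_ofNat_of_zero_le (show 0 ≤ b - a by omega)
      obtain rfl : a = k - n := by omega
      obtain rfl : b = ((i + k : ℕ) : ℤ) - n := by push_cast; omega
      rw [shiftedDigits_natCast_sub] at ha ⊢
      rw [Function.iterate_add_apply]
      exact h.digit_iterate_eq_zero hτ0 hw ha (by omega) (by omega)
    rintro a ⟨ha1, ha2, ha⟩ b ⟨hb1, hb2, hb⟩
    rcases lt_trichotomy a b with hab | hab | hab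
    · exact absurd (key a b hab (by omega) ha) hb
    · exact hab
    · exact absurd (key b a hab (by omega) hb) ha

lemma hasValue_shiftedDigits (h : IsDigitMap w D d T) (hτ0 : τ ≠ 0) {y : ZTau τ} {k : ℕ}
    (hk : T^[k] y = 0) (n : ℕ) : HasValue (shiftedDigits d T y n) (y / τ ^ n) := by
  have hinj : Function.Injective (fun i : ℕ => (i : ℤ) - n) := fun a b hab => by
    simp only at hab
    omega
  rw [HasValue, ← hinj.hasSum_iff]
  · have e : (fun j : ℤ => (shiftedDigits d T y n j : ℂ) * τ ^ j) ∘ (fun i : ℕ => (i : ℤ) - n)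
        = fun i : ℕ => (d (T^[i] y) : ℂ) * τ ^ i / τ ^ n := by
      funext i
      simp only [Function.comp_apply, shiftedDigits_natCast_sub]
      rw [zpow_sub₀ hτ0, zpow_natCast, zpow_natCast, mul_div_assoc]
    rw [e]
    apply HasSum.div_const
    have h1 := h.sum_range_add y k
    rw [hk, ZeroMemClass.coe_zero, mul_zero, add_zero] at h1
    rw [h1]
    apply hasSum_sum_of_ne_finset_zero
    intro i hi
    rw [h.iterate_eq_zero_of_le hτ0 (by simpa using hi) hk, h.eq_zero 0 (dvd_zero _)]
    simp
  · intro j hj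
    have : ¬ -(n : ℤ) ≤ j := fun hc => hj ⟨(j + n).toNat, by simp only; omega⟩
    simp [shiftedDigits, this]

end IsDigitMap

/-! ### Passage to the limit -/

lemma leftLength_lt_top {η : ℤ → ZTau τ} {L : ℕ} (hη : ∀ j : ℤ, L ≤ j → η j = 0) :
    leftLength η < ⊤ := by
  refine lt_of_le_of_lt (iSup₂_le fun j hj => ?_) (ENat.natCast_lt_top L)
  have : j < L := not_le.1 fun hc => hj (hη j hc)
  exact_mod_cast (by omega : (j + 1).toNat ≤ L)

/-- Sequences of `w`-NAFs over a finite digit set whose left-lengths are bounded have a subsequence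
that is eventually constant in each position, and the value of the limit is the limit of the
values. -/
lemma exists_wnaf_of_tendsto (hτ1 : 1 < ‖τ‖) (hDfin : D.Finite) {ξ : ℕ → ℤ → ZTau τ} {x : ℕ → ℂ}
    {z : ℂ} {L : ℕ} (hξ : ∀ n, IsWNAF w D (ξ n)) (hL : ∀ n (j : ℤ), L ≤ j → ξ n j = 0)
    (hval : ∀ n, HasValue (ξ n) (x n)) (hx : Tendsto x atTop (𝓝 z)) :
    ∃ η ∈ wnafFinInf w D, HasValue η z := by
  have hτ0 : τ ≠ 0 := by rintro rfl; simp at hτ1; linarith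
  -- `D` carries the discrete topology, in which the space of digit sequences is compact
  let : TopologicalSpace D := ⊥
  have : DiscreteTopology D := ⟨rfl⟩
  have : Finite D := hDfin
  obtain ⟨η, φ, hφ, hlim⟩ :=
    CompactSpace.tendsto_subseq (fun n (j : ℤ) => (⟨ξ n j, (hξ n).digit_mem j⟩ : D))
  have hev : ∀ j, ∀ᶠ n in atTop, ξ (φ n) j = η j := by
    intro j
    have h1 := (tendsto_pi_nhds.1 hlim) j
    rw [nhds_discrete, tendsto_pure] at h1
    filter_upwards [h1] with n hn
    simpa using congrArg Subtype.val hn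
  have hη0 : ∀ j : ℤ, L ≤ j → (η j : ZTau τ) = 0 := by
    intro j hj
    obtain ⟨n, hn⟩ := (hev j).exists
    rw [← hn, hL _ _ hj]
  obtain ⟨M, hM⟩ := (hDfin.image fun y : ZTau τ => ‖(y : ℂ)‖).bddAbove
  replace hM : ∀ y ∈ D, ‖(y : ℂ)‖ ≤ M := fun y hy => hM ⟨y, hy, rfl⟩
  -- the series are dominated by `M ∑ ‖τ‖ ^ j` over `j < L`
  set bound : ℤ → ℝ := fun j => if (L : ℤ) ≤ j then 0 else M * ‖τ‖ ^ j
  have hbound : Summable bound := by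
    have hinj : Function.Injective (fun i : ℕ => (L : ℤ) - 1 - i) := fun a b hab => by
      simp only at hab
      omega
    rw [← hinj.summable_iff]
    · have e : bound ∘ (fun i : ℕ => (L : ℤ) - 1 - i)
          = fun i : ℕ => M * ‖τ‖ ^ ((L : ℤ) - 1) * (‖τ‖⁻¹) ^ i := by
        funext i
        have : ¬ (L : ℤ) ≤ L - 1 - i := by omega
        simp only [bound, Function.comp_apply, this, if_false]
        rw [zpow_sub₀ (norm_ne_zero_iff.2 hτ0), zpow_natCast, inv_pow, mul_assoc, div_eq_mul_inv]
      rw [e]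
      exact (summable_geometric_of_lt_one (by positivity) (inv_lt_one_of_one_lt₀ hτ1)).mul_left _
    · intro j hj
      have : (L : ℤ) ≤ j := not_lt.1 fun hc => hj ⟨((L : ℤ) - 1 - j).toNat, by simp only; omega⟩
      simp [bound, this]
  have hle : ∀ (f : ℤ → ZTau τ), (∀ j, f j ∈ D) → (∀ j : ℤ, L ≤ j → f j = 0) →
      ∀ j, ‖(f j : ℂ) * τ ^ j‖ ≤ bound j := by
    intro f hf hfL j
    by_cases hj : (L : ℤ) ≤ j
    · simp [bound, hj, hfL j hj]
    · simp only [bound, hj, if_false, norm_mul, norm_zpow]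
      exact mul_le_mul_of_nonneg_right (hM _ (hf j)) (by positivity)
  refine ⟨fun j => η j, ⟨⟨fun j => (η j).2, ?_⟩, leftLength_lt_top hη0⟩, ?_⟩
  · rintro j a ⟨ha1, ha2, ha⟩ b ⟨hb1, hb2, hb⟩
    obtain ⟨n, hna, hnb⟩ := ((hev a).and (hev b)).exists
    exact (hξ (φ n)).block j ⟨ha1, ha2, hna ▸ ha⟩ ⟨hb1, hb2, hnb ▸ hb⟩
  · have hsum : Summable fun j : ℤ => ((η j : ZTau τ) : ℂ) * τ ^ j :=
      hbound.of_norm_bounded (hle _ (fun j => (η j).2) hη0)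
    have hdom : Tendsto (fun n => ∑' j : ℤ, (ξ (φ n) j : ℂ) * τ ^ j) atTop
        (𝓝 (∑' j : ℤ, ((η j : ZTau τ) : ℂ) * τ ^ j)) := by
      refine tendsto_tsum_of_dominated_convergence hbound (fun j => ?_)
        (Eventually.of_forall fun n => hle _ (hξ _).digit_mem (hL _))
      refine tendsto_const_nhds.congr' ?_
      filter_upwards [hev j] with n hn
      rw [hn]
    have hx' : Tendsto (fun n => ∑' j : ℤ, (ξ (φ n) j : ℂ) * τ ^ j) atTop (𝓝 z) := by
      refine (hx.comp hφ.tendsto_atTop).congr fun n => ?_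
      exact (hval (φ n)).tsum_eq.symm
    rw [HasValue, tendsto_nhds_unique hx' hdom]
    exact hsum.hasSum

end WNAF

/-- Every complex number is the value of a width-`w` non-adjacent form of finite left-length. -/
theorem mainTheorem4 (τ : ℂ) (hτ : WNAF.IsImagQuadraticInteger τ) (hτ1 : 1 < ‖τ‖)
    (w : ℕ) (hw : 2 ≤ w)
    (m : ℕ) (v : ZMod m → ℂ) (hv : WNAF.IsVertexLabelling τ m v)
    (D : Set (WNAF.ZTau τ)) (hD : WNAF.IsMinNormDigitSet τ w m v D) (z : ℂ) :
    ∃ ξ ∈ WNAF.wnafFinInf w D, WNAF.HasValue ξ z := by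
  obtain ⟨p, q, hpq, hroot⟩ := hτ
  have hτ0 : τ ≠ 0 := by rintro rfl; simp at hτ1; linarith
  have ht : 0 < ‖τ‖ := by linarith
  have hw0 : w ≠ 0 := by omega
  have hDr := hD.toIsReducedResidueDigitSet
  obtain ⟨d, T, h⟩ := hDr.exists_isDigitMap hw0
  have hterm := h.exists_iterate_eq_zero hDr hpq hroot hτ1 hw
    (fun η hη x => hD.norm_le_norm_sub hv hη x)
  set M : ℝ := ‖τ‖ ^ w * ((1 + ‖τ‖) / 2)
  have hM : ∀ η ∈ D, ‖(η : ℂ)‖ ≤ M := fun η hη => hD.norm_le hpq hroot hτ0 hv hη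
  set C : ℝ := (1 + ‖τ‖) / 2
  have hC : 0 ≤ C := by positivity
  choose y hy using fun n : ℕ => WNAF.exists_norm_sub_le hpq hroot (τ ^ n * z)
  -- the iterates `T^[n] (y n)` stay in a finite set, all of whose elements have length at most `L`
  obtain ⟨L, hL⟩ : ∃ L : ℕ, ∀ n, T^[L] (T^[n] (y n)) = 0 := by
    choose k hk using hterm
    obtain ⟨L, hL⟩ :=
      ((WNAF.finite_norm_le hpq hroot (‖z‖ + C + M / (‖τ‖ - 1))).image k).bddAbove
    refine ⟨L, fun n => h.iterate_eq_zero_of_le hτ0 (hL ⟨_, ?_, rfl⟩) (hk _)⟩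
    refine (h.norm_iterate_le hτ1 hM (y n) n).trans ?_
    gcongr
    rw [div_le_iff₀ (by positivity)]
    have h1 : ‖(y n : ℂ)‖ ≤ ‖τ ^ n * z‖ + ‖τ ^ n * z - y n‖ := by
      have := norm_sub_le (τ ^ n * z) (τ ^ n * z - y n)
      rwa [sub_sub_cancel] at this
    rw [norm_mul, norm_pow] at h1
    have h2 : C ≤ C * ‖τ‖ ^ n := le_mul_of_one_le_right hC (one_le_pow₀ hτ1.le)
    have h3 : ‖τ ^ n * z - y n‖ ≤ C := hy n
    linarith
  refine WNAF.exists_wnaf_of_tendsto (ξ := fun n => WNAF.shiftedDigits d T (y n) n)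
    (x := fun n => (y n : ℂ) / τ ^ n) (L := L) hτ1 ?_
    (fun n => h.isWNAF_shiftedDigits hDr hτ0 hw0 _ _) ?_
    (fun n => h.hasValue_shiftedDigits hτ0 (hterm (y n)).choose_spec n) ?_
  · exact (WNAF.finite_norm_le hpq hroot M).subset hM
  · intro n j hj
    have hnj : -(n : ℤ) ≤ j := by omega
    have e : (j + n).toNat = (j - L).toNat + L + n := by omega
    simp only [WNAF.shiftedDigits, hnj, if_true]
    rw [e, Function.iterate_add_apply, Function.iterate_add_apply, hL, h.iterate_zero hτ0,
      h.eq_zero 0 (dvd_zero _)]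
  · rw [tendsto_iff_norm_sub_tendsto_zero]
    have hlim : Filter.Tendsto (fun n : ℕ => C * (‖τ‖⁻¹) ^ n) Filter.atTop (nhds 0) := by
      simpa using (tendsto_pow_atTop_nhds_zero_of_lt_one (by positivity)
        (inv_lt_one_of_one_lt₀ hτ1)).const_mul C
    refine squeeze_zero (fun n => norm_nonneg _) (fun n => ?_) hlim
    have e : (y n : ℂ) / τ ^ n - z = -((τ ^ n * z - y n) / τ ^ n) := by
      field_simp
      ring
    rw [e, norm_neg, norm_div, norm_pow, inv_pow, ← div_eq_mul_inv]
    gcongr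
    exact hy n
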